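/- Let $G$ be a finite simple graph with vertex set $V$. A color change rule says when a blue vertex $u$ can force a white vertex $v$, given that $B\subseteq V$ is the set of blue vertices. Under the standard rule, $u$ can force $v$ if $v$ is the only white neighbor of $u$. Under the positive semidefinite (PSD) rule, $u$ can force $v$ if, for some connected component $C$ of $G-B$, $v$ is the only neighbor of $u$ in $C$. For a fixed rule and an initial set $B$, let $B^{[0]}=B$, let $B^{(k)}$ be the set of vertices that can be forced by some vertex when the blue set is $B^{[k-1]}$, and let $B^{[k]}=B^{[k-1]}\cup B^{(k)}$ for $k\ge 1$. The set $B$ is a forcing set if $B^{[k]}=V$ for some $k$, and the least such $k$ is its propagation time, denoted $\mathrm{pt}(G,B)$ for the standard rule and $\mathrm{pt}_+(G,B)$ for the PSD rule. Let $\mathrm{Z}(G)$ be the minimum size of a standard forcing set, and let $\mathrm{pt}(G,m)$ and $\mathrm{pt}_+(G,m)$ be the minimum of $\mathrm{pt}(G,B)$, respectively $\mathrm{pt}_+(G,B)$, over all standard, respectively PSD, forcing sets $B$ with $|B|=m$. If $B$ is a standard forcing set with $t=\mathrm{pt}(G,B)$, a propagating family of forces $\mathcal F=\{F^{(k)}\}_{k=1}^{t}$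 of $B$ is obtained by choosing, for each $1\le k\le t$ and each $u\in B^{(k)}$, one vertex $v_u$ that can force $u$ under the standard rule when the blue set is $B^{[k-1]}$, and setting $F^{(k)}=\{v_u\to u: u\in B^{(k)}\}$. For $0\le N\le t$, let $V_{\mathcal F}^{N}$ be the set of vertices active at time-step $N$, i.e. the vertices that belong to $B^{[N]}$ and perform no force in $F^{(1)}\cup\dots\cup F^{(N)}$. **Theorem.** Let $m$ be an integer with $\mathrm{Z}(G)\le m\le |V|$. Then $$\mathrm{pt}_+(G,m)\le\left\lceil \frac{\mathrm{pt}(G,m)}{2}\right\rceil .$$ Moreover, put $N=\lceil \mathrm{pt}(G,m)/2\rceil$. There is a standard forcing set $B$ with $|B|=m$ and $\mathrm{pt}(G,B)=\mathrm{pt}(G,m)$, and it has a propagating family of forces; and for every such $B$ and every propagating family $\mathcal F$ of forces of $B$, the set $V_{\mathcal F}^{N}$ is a PSD forcing set of $G$ with $|V_{\mathcal F}^{N}|=m$ and $\mathrm{pt}_+(G,V_{\mathcal F}^{N})\le N$. -/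

import Mathlib

namespace ZeroForcing

variable {V : Type*}

/-- A color change rule on the vertex set `V`: `R B u v` means that `u` can force `v` to become blue
when exactly the vertices in `B` are blue. -/
abbrev ColorChangeRule (V : Type*) := Set V → V → V → Prop

/-- The standard zero forcing rule: the blue vertex `u` has `v` as its unique white neighbor. -/
def standardRule (G : SimpleGraph V) : ColorChangeRule V := fun B u v =>
  u ∈ B ∧ G.neighborSet u ∩ Bᶜ = {v}

/-- The positive semidefinite rule: `u` is blue and, for some connected component `C` of `G - B`,
`v` is the unique neighbor of `u` in `C`. -/
def psdRule (G : SimpleGraph V) : ColorChangeRule V := fun B u v =>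
  u ∈ B ∧ ∃ C : (G.induce Bᶜ).ConnectedComponent,
    G.neighborSet u ∩ (Subtype.val '' C.supp) = {v}

/-- The set of vertices that are blue after time-step `k` of the propagation process from `B`. -/
def blueAfter (R : ColorChangeRule V) (B : Set V) : ℕ → Set V
  | 0 => B
  | k + 1 => blueAfter R B k ∪ {w | ∃ v, R (blueAfter R B k) v w}

/-- The set of vertices that are forced during time-step `k` of the propagation process from `B`
(with the initial set `B` itself at `k = 0`). -/
def newlyBlue (R : ColorChangeRule V) (B : Set V) : ℕ → Set V
  | 0 => B
  | k + 1 => {w | ∃ v, R (blueAfter R B k) v w}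

/-- Starting from `B`, all vertices eventually become blue. -/
def IsForcingSet (R : ColorChangeRule V) (B : Set V) : Prop :=
  ∃ k, blueAfter R B k = Set.univ

/-- The minimum cardinality of a forcing set. -/
noncomputable def forcingNumber (R : ColorChangeRule V) : ℕ :=
  sInf {n | ∃ B : Set V, IsForcingSet R B ∧ B.ncard = n}

/-- The propagation time of a forcing set `B`: the least `k` such that all vertices are blue after
time-step `k`. (Only meaningful when `B` is a forcing set.) -/
noncomputable def propTime (R : ColorChangeRule V) (B : Set V) : ℕ :=
  sInf {k | blueAfter R B k = Set.univ}

/-- The `m`-propagation time: the least propagation time of a forcing set of cardinality `m`.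
(Only meaningful when there is such a forcing set.) -/
noncomputable def propTimeOfSize (R : ColorChangeRule V) (m : ℕ) : ℕ :=
  sInf {t | ∃ B : Set V, IsForcingSet R B ∧ B.ncard = m ∧ propTime R B = t}

/-- `B` is an `m`-efficient forcing set. -/
def IsEfficientForcingSet (R : ColorChangeRule V) (m : ℕ) (B : Set V) : Prop :=
  IsForcingSet R B ∧ B.ncard = m ∧ propTime R B = propTimeOfSize R m

/-- `F 1, …, F t`, where `t` is the propagation time of `B`, is a propagating family of forces of
the forcing set `B`: for every vertex `u` forced during a time-step `k + 1 ≤ t`, one vertex `p u`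
that can force `u` at that time is chosen, and `F (k + 1)` consists of the forces `p u → u`, written
as pairs `(p u, u)`. The sets `F k` for other indices `k` are irrelevant. -/
def IsPropagatingFamily (R : ColorChangeRule V) (B : Set V) (F : ℕ → Set (V × V)) : Prop :=
  ∃ p : V → V, ∀ k < propTime R B,
    (∀ u ∈ newlyBlue R B (k + 1), R (blueAfter R B k) (p u) u) ∧
    F (k + 1) = {f | ∃ u ∈ newlyBlue R B (k + 1), f = (p u, u)}

/-- The set of vertices that are active at time-step `N`: those that are blue after time-step `N`
and have not performed a force of `F` in any of the time-steps `1, …, N`. -/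
def activeSet (R : ColorChangeRule V) (B : Set V) (F : ℕ → Set (V × V)) (N : ℕ) : Set V :=
  {v | v ∈ blueAfter R B N ∧ ∀ k, 1 ≤ k → k ≤ N → ∀ u, (v, u) ∉ F k}

/-- The standard zero forcing number `Z(G)`. -/
noncomputable def Z (G : SimpleGraph V) : ℕ := forcingNumber (standardRule G)

/-- The standard `m`-propagation time `pt(G, m)`. -/
noncomputable def pt (G : SimpleGraph V) (m : ℕ) : ℕ := propTimeOfSize (standardRule G) m

/-- The PSD `m`-propagation time `pt₊(G, m)`. -/
noncomputable def ptPlus (G : SimpleGraph V) (m : ℕ) : ℕ := propTimeOfSize (psdRule G) m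

end ZeroForcing

/-!
Fix a standard forcing set `B` with propagation time `t`, a choice `p u` of a forcer for every
vertex `u` outside `B`, and a time-step `N ≤ t`. Let `S` be the set of vertices active at time `N`,
`L` the set of vertices that have performed a force by time `N`, and `W` the set of vertices that
are still white at time `N`, so that `V` is the disjoint union of `L`, `S` and `W`.

No vertex performs two forces, since all its neighbors are blue after its first one. Hence `p` is a
bijection from the vertices forced by time `N` onto `L`, and `|S| = |B|`
(`ChoosesForcers.ncard_blueAfter_diff_forcersBy`). For the same reason there are no
edges between `L` and `W`, so every component of `G - S` lies in `L` or in `W`, and under the PSD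
rule these two sides evolve independently from `S`:

* in `W` the original forces continue, so the vertices forced at time `N + j` are blue after `j`
  PSD steps (`ChoosesForcers.blueAfter_subset_psd_blueAfter`);
* in `L` the original forces can be reversed, so the vertices that perform a force at time
  `N - j + 1` are blue after `j` PSD steps (`ChoosesForcers.forcer_mem_psd_blueAfter`).

Everything is therefore blue after `max N (t - N)` PSD steps, which is `⌈t / 2⌉` for the choice
`N = ⌈t / 2⌉`. Efficient standard forcing sets of size `m` exist because a superset of a standard
forcing set is a standard forcing set.
-/

namespace ZeroForcing

variable {V : Type*} {G : SimpleGraph V} {B : Set V}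

lemma blueAfter_mono (R : ColorChangeRule V) (B : Set V) : Monotone (blueAfter R B) :=
  monotone_nat_of_le_succ fun _ => Set.subset_union_left

lemma newlyBlue_subset_blueAfter {R : ColorChangeRule V} {k n : ℕ} (h : k < n) :
    newlyBlue R B (k + 1) ⊆ blueAfter R B n :=
  fun _ hu => blueAfter_mono R B (Nat.succ_le_of_lt h) (Or.inr hu)

lemma mem_blueAfter_iff {R : ColorChangeRule V} {n : ℕ} {u : V} :
    u ∈ blueAfter R B n ↔ u ∈ B ∨ ∃ k < n, u ∈ newlyBlue R B (k + 1) := by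
  constructor
  · induction n with
    | zero => exact Or.inl
    | succ n ih =>
      rintro (h | h)
      · rcases ih h with h | ⟨k, hk, h⟩
        · exact Or.inl h
        · exact Or.inr ⟨k, hk.trans n.lt_succ_self, h⟩
      · exact Or.inr ⟨n, n.lt_succ_self, h⟩
  · rintro (h | ⟨k, hk, h⟩)
    · exact blueAfter_mono R B n.zero_le h
    · exact newlyBlue_subset_blueAfter hk h

lemma IsForcingSet.blueAfter_propTime {R : ColorChangeRule V} (h : IsForcingSet R B) :
    blueAfter R B (propTime R B) = Set.univ :=
  Nat.sInf_mem (s := {k | blueAfter R B k = Set.univ}) h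

/-! ### The standard rule -/

lemma standardRule.adj {v u : V} (h : standardRule G B v u) : G.Adj v u :=
  (h.2.ge rfl).1

lemma standardRule.notMem {v u : V} (h : standardRule G B v u) : u ∉ B :=
  (h.2.ge rfl).2

lemma standardRule.eq_of_adj {v u x : V} (h : standardRule G B v u) (hx : G.Adj v x)
    (hxB : x ∉ B) : x = u :=
  h.2.le ⟨hx, hxB⟩

lemma notMem_blueAfter_of_newlyBlue {k : ℕ} {u : V}
    (hu : u ∈ newlyBlue (standardRule G) B (k + 1)) : u ∉ blueAfter (standardRule G) B k := by
  obtain ⟨v, hv⟩ := hu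
  exact hv.notMem

lemma lt_of_newlyBlue_of_mem_blueAfter {k n : ℕ} {u : V}
    (hu : u ∈ newlyBlue (standardRule G) B (k + 1)) (hn : u ∈ blueAfter (standardRule G) B n) :
    k < n := by
  by_contra! h
  exact notMem_blueAfter_of_newlyBlue hu (blueAfter_mono _ _ h hn)

lemma newlyBlue_time_unique {k l : ℕ} {u : V} (hk : u ∈ newlyBlue (standardRule G) B (k + 1))
    (hl : u ∈ newlyBlue (standardRule G) B (l + 1)) : k = l :=
  le_antisymm
    (Nat.le_of_lt_succ <| lt_of_newlyBlue_of_mem_blueAfter hk <|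
      newlyBlue_subset_blueAfter l.lt_succ_self hl)
    (Nat.le_of_lt_succ <| lt_of_newlyBlue_of_mem_blueAfter hl <|
      newlyBlue_subset_blueAfter k.lt_succ_self hk)

/-- All neighbors of a vertex that performs a force at time `k + 1` are blue from then on. -/
lemma mem_blueAfter_of_adj_forcer {k n : ℕ} {v u x : V}
    (h : standardRule G (blueAfter (standardRule G) B k) v u) (hx : G.Adj v x) (hn : k < n) :
    x ∈ blueAfter (standardRule G) B n := by
  refine blueAfter_mono _ _ (Nat.succ_le_of_lt hn) ?_
  by_cases hxB : x ∈ blueAfter (standardRule G) B k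
  · exact Or.inl hxB
  · exact Or.inr ⟨v, h.eq_of_adj hx hxB ▸ h⟩

lemma blueAfter_standardRule_subset {B B' : Set V} (h : B ⊆ B') (k : ℕ) :
    blueAfter (standardRule G) B k ⊆ blueAfter (standardRule G) B' k := by
  induction k with
  | zero => exact h
  | succ k ih =>
    rintro u (hu | ⟨v, hv⟩)
    · exact Or.inl (ih hu)
    · by_cases huB : u ∈ blueAfter (standardRule G) B' k
      · exact Or.inl huB
      · refine Or.inr ⟨v, ih hv.1, Set.Subset.antisymm ?_ ?_⟩
        · rintro x ⟨hx, hxB⟩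
          exact hv.eq_of_adj hx fun hx' => hxB (ih hx')
        · rintro _ rfl
          exact ⟨hv.adj, huB⟩

lemma IsForcingSet.mono_standardRule {B B' : Set V} (hB : IsForcingSet (standardRule G) B)
    (h : B ⊆ B') : IsForcingSet (standardRule G) B' := by
  obtain ⟨k, hk⟩ := hB
  exact ⟨k, Set.univ_subset_iff.mp (hk ▸ blueAfter_standardRule_subset h k)⟩

lemma exists_isPropagatingFamily (G : SimpleGraph V) (B : Set V) :
    ∃ F, IsPropagatingFamily (standardRule G) B F := by
  have h : ∀ u, ∃ v, ∀ k, u ∈ newlyBlue (standardRule G) B (k + 1) →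
      standardRule G (blueAfter (standardRule G) B k) v u := by
    intro u
    by_cases hu : ∃ k, u ∈ newlyBlue (standardRule G) B (k + 1)
    · obtain ⟨k, hk⟩ := hu
      obtain ⟨v, hv⟩ := id hk
      exact ⟨v, fun l hl => newlyBlue_time_unique hk hl ▸ hv⟩
    · exact ⟨u, fun k hk => (hu ⟨k, hk⟩).elim⟩
  choose p hp using h
  refine ⟨fun k => {f | ∃ u ∈ newlyBlue (standardRule G) B k, f = (p u, u)}, p, fun k _ => ?_⟩
  exact ⟨fun u hu => hp u k hu, rfl⟩

lemma exists_isForcingSet_ncard_eq [Fintype V] {m : ℕ} (hm : Z G ≤ m)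
    (hmV : m ≤ Fintype.card V) :
    ∃ B : Set V, IsForcingSet (standardRule G) B ∧ B.ncard = m := by
  have hne : {n | ∃ B : Set V, IsForcingSet (standardRule G) B ∧ B.ncard = n}.Nonempty :=
    ⟨_, Set.univ, ⟨0, rfl⟩, rfl⟩
  obtain ⟨B, hB, hcard⟩ := Nat.sInf_mem hne
  obtain ⟨B', hsub, -, hB'⟩ := Set.exists_subsuperset_card_eq (Set.subset_univ B)
    (hcard.trans_le hm) (by rwa [Set.ncard_univ, Nat.card_eq_fintype_card])
  exact ⟨B', hB.mono_standardRule hsub, hB'⟩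

lemma exists_isEfficientForcingSet [Fintype V] {m : ℕ} (hm : Z G ≤ m)
    (hmV : m ≤ Fintype.card V) :
    ∃ B : Set V, IsEfficientForcingSet (standardRule G) m B := by
  obtain ⟨B, hB, hcard⟩ := exists_isForcingSet_ncard_eq hm hmV
  have hne : {t | ∃ B : Set V, IsForcingSet (standardRule G) B ∧ B.ncard = m ∧
      propTime (standardRule G) B = t}.Nonempty := ⟨_, B, hB, hcard, rfl⟩
  exact Nat.sInf_mem hne

/-! ### Chosen forcers and the active set -/

/-- `p` picks a valid forcer under the standard rule, started from `B`, for every vertex that is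
forced during one of the time-steps `1, …, T`. -/
def ChoosesForcers (G : SimpleGraph V) (B : Set V) (p : V → V) (T : ℕ) : Prop :=
  ∀ k < T, ∀ u ∈ newlyBlue (standardRule G) B (k + 1),
    standardRule G (blueAfter (standardRule G) B k) (p u) u

/-- The vertices that have performed a force `p u → u` during one of the time-steps `1, …, N`. -/
def forcersBy (G : SimpleGraph V) (B : Set V) (p : V → V) (N : ℕ) : Set V :=
  {v | ∃ k < N, ∃ u ∈ newlyBlue (standardRule G) B (k + 1), p u = v}

variable {p : V → V} {T N : ℕ}

/-- A vertex performs at most one force. -/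
lemma ChoosesForcers.eq_of_forcer_eq (hp : ChoosesForcers G B p T) {k l : ℕ} {u w : V}
    (hk : k < T) (hl : l < T) (hu : u ∈ newlyBlue (standardRule G) B (k + 1))
    (hw : w ∈ newlyBlue (standardRule G) B (l + 1)) (h : p u = p w) : u = w := by
  have hfu := hp k hk u hu
  have hfw := hp l hl w hw
  have hlk : l < k + 1 := lt_of_newlyBlue_of_mem_blueAfter hw
    (mem_blueAfter_of_adj_forcer hfu (h ▸ hfw.adj) k.lt_succ_self)
  have hkl : k < l + 1 := lt_of_newlyBlue_of_mem_blueAfter hu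
    (mem_blueAfter_of_adj_forcer hfw (h ▸ hfu.adj) l.lt_succ_self)
  obtain rfl : k = l := by omega
  exact hfw.eq_of_adj (h ▸ hfu.adj) hfu.notMem

lemma ChoosesForcers.forcersBy_subset (hp : ChoosesForcers G B p T) (hN : N ≤ T) :
    forcersBy G B p N ⊆ blueAfter (standardRule G) B N := by
  rintro _ ⟨k, hk, u, hu, rfl⟩
  exact blueAfter_mono _ _ hk.le (hp k (hk.trans_le hN) u hu).1

/-- There are no edges between the vertices that have performed a force and the white vertices. -/
lemma ChoosesForcers.mem_blueAfter_of_adj (hp : ChoosesForcers G B p T) (hN : N ≤ T) {v x : V}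
    (hv : v ∈ forcersBy G B p N) (hx : G.Adj v x) : x ∈ blueAfter (standardRule G) B N := by
  obtain ⟨k, hk, u, hu, rfl⟩ := hv
  exact mem_blueAfter_of_adj_forcer (hp k (hk.trans_le hN) u hu) hx hk

lemma ChoosesForcers.ncard_blueAfter_diff_forcersBy [Finite V] (hp : ChoosesForcers G B p T)
    (hN : N ≤ T) :
    (blueAfter (standardRule G) B N \ forcersBy G B p N).ncard = B.ncard := by
  have himage : forcersBy G B p N = p '' (blueAfter (standardRule G) B N \ B) := by
    ext v
    constructor
    · rintro ⟨k, hk, u, hu, rfl⟩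
      exact ⟨u, ⟨newlyBlue_subset_blueAfter hk hu, fun huB =>
        notMem_blueAfter_of_newlyBlue hu (blueAfter_mono _ _ k.zero_le huB)⟩, rfl⟩
    · rintro ⟨u, ⟨hu, huB⟩, rfl⟩
      obtain ⟨k, hk, hu⟩ := (mem_blueAfter_iff.mp hu).resolve_left huB
      exact ⟨k, hk, u, hu, rfl⟩
  have hinj : Set.InjOn p (blueAfter (standardRule G) B N \ B) := by
    rintro u ⟨hu, huB⟩ w ⟨hw, hwB⟩ h
    obtain ⟨k, hk, hu⟩ := (mem_blueAfter_iff.mp hu).resolve_left huB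
    obtain ⟨l, hl, hw⟩ := (mem_blueAfter_iff.mp hw).resolve_left hwB
    exact hp.eq_of_forcer_eq (hk.trans_le hN) (hl.trans_le hN) hu hw h
  have hcard : (forcersBy G B p N).ncard = (blueAfter (standardRule G) B N \ B).ncard := by
    rw [himage, hinj.ncard_image]
  have h₁ := Set.ncard_sdiff_add_ncard_of_subset (hp.forcersBy_subset hN)
  have hB : B ⊆ blueAfter (standardRule G) B N := blueAfter_mono (standardRule G) B N.zero_le
  have h₂ := Set.ncard_sdiff_add_ncard_of_subset hB
  omega

/-- A propagating family amounts to a choice of forcers `p`, and its active set at time `N` is the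
blue set at time `N` without the vertices that have performed a force. -/
lemma IsPropagatingFamily.exists_choosesForcers {F : ℕ → Set (V × V)}
    (hF : IsPropagatingFamily (standardRule G) B F) :
    ∃ p, ChoosesForcers G B p (propTime (standardRule G) B) ∧
      ∀ N ≤ propTime (standardRule G) B, activeSet (standardRule G) B F N =
        blueAfter (standardRule G) B N \ forcersBy G B p N := by
  obtain ⟨p, hp⟩ := hF
  refine ⟨p, fun k hk => (hp k hk).1, fun N hN => ?_⟩
  ext v
  refine and_congr_right fun _ => ⟨?_, ?_⟩
  · rintro h ⟨k, hk, u, hu, rfl⟩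
    refine h (k + 1) k.succ_pos hk u ?_
    rw [(hp k (hk.trans_le hN)).2]
    exact ⟨u, hu, rfl⟩
  · rintro h (_ | k) hk₁ hk u hu
    · exact absurd hk₁ (by omega)
    · rw [(hp k (lt_of_lt_of_le hk hN)).2] at hu
      obtain ⟨w, hw, heq⟩ := hu
      exact h ⟨k, hk, w, hw, (congrArg Prod.fst heq).symm⟩

/-! ### PSD propagation from the active set -/

/-- A criterion for PSD forces that does not mention components: `W` is a union of components of
`G - P`, up to vertices of `P`, in which `u` is the only white neighbor of `v`. -/
lemma psdRule_of_closed {P W : Set V} {v u : V} (hv : v ∈ P) (hu : u ∉ P) (huW : u ∈ W)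
    (hvu : G.Adj v u) (hW : ∀ x ∈ W, ∀ y, x ∉ P → y ∉ P → G.Adj x y → y ∈ W)
    (huniq : ∀ y ∈ W, y ∉ P → G.Adj v y → y = u) : psdRule G P v u := by
  refine ⟨hv, (G.induce Pᶜ).connectedComponentMk ⟨u, hu⟩, Set.Subset.antisymm ?_ ?_⟩
  · rintro _ ⟨hy, y, hyC, rfl⟩
    have hreach : (G.induce Pᶜ).Reachable ⟨u, hu⟩ y :=
      (SimpleGraph.ConnectedComponent.exact hyC).symm
    rw [SimpleGraph.reachable_iff_reflTransGen] at hreach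
    have hyW : (y : V) ∈ W := by
      clear hy hyC
      induction hreach with
      | refl => exact huW
      | @tail x z _ hxz ih => exact hW x ih z x.2 z.2 hxz
    exact huniq _ hyW y.2 hy
  · rintro _ rfl
    exact ⟨hvu, ⟨_, hu⟩, rfl, rfl⟩

/-- On the side that is white at time `N`, the original forces continue under the PSD rule. -/
lemma ChoosesForcers.blueAfter_subset_psd_blueAfter (hp : ChoosesForcers G B p T) {j : ℕ}
    (hj : N + j ≤ T) :
    blueAfter (standardRule G) B (N + j) \ forcersBy G B p N ⊆
      blueAfter (psdRule G) (blueAfter (standardRule G) B N \ forcersBy G B p N) j := by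
  induction j with
  | zero => exact subset_rfl
  | succ j ih =>
    have hj' : N + j < T := hj
    have hNT : N ≤ T := by omega
    specialize ih hj'.le
    rintro u ⟨hu | hu, huL⟩
    · exact Or.inl (ih ⟨hu, huL⟩)
    · by_cases huP : u ∈ blueAfter (psdRule G)
        (blueAfter (standardRule G) B N \ forcersBy G B p N) j
      · exact Or.inl huP
      have hf := hp _ hj' u hu
      have huN : u ∉ blueAfter (standardRule G) B N := fun h =>
        hf.notMem (blueAfter_mono _ _ (Nat.le_add_right N j) h)
      refine Or.inr ⟨p u, psdRule_of_closed (W := (blueAfter (standardRule G) B N)ᶜ)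
        (ih ⟨hf.1, fun h => huN (hp.mem_blueAfter_of_adj hNT h hf.adj)⟩) huP huN hf.adj ?_ ?_⟩
      · intro x hx y _ hy hxy hyN
        by_cases hyL : y ∈ forcersBy G B p N
        · exact hx (hp.mem_blueAfter_of_adj hNT hyL hxy.symm)
        · exact hy (blueAfter_mono _ _ j.zero_le ⟨hyN, hyL⟩)
      · intro y hyN hyP hy
        refine hf.eq_of_adj hy fun hyj => hyP (ih ⟨hyj, fun hyL => hyN ?_⟩)
        exact hp.forcersBy_subset hNT hyL

/-- On the side of the vertices that have performed a force by time `N`, the original forces are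
reversed under the PSD rule, the latest ones first. -/
lemma ChoosesForcers.forcer_mem_psd_blueAfter (hp : ChoosesForcers G B p T) (hN : N ≤ T) (j : ℕ)
    {k : ℕ} (hk : k < N) (hkj : N ≤ k + j) {w : V}
    (hw : w ∈ newlyBlue (standardRule G) B (k + 1)) :
    p w ∈ blueAfter (psdRule G) (blueAfter (standardRule G) B N \ forcersBy G B p N) j := by
  induction j generalizing k w with
  | zero => omega
  | succ j ih =>
    by_cases huP : p w ∈ blueAfter (psdRule G)
      (blueAfter (standardRule G) B N \ forcersBy G B p N) j
    · exact Or.inl huP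
    have hf := hp k (hk.trans_le hN) w hw
    refine Or.inr ⟨w, psdRule_of_closed (W := forcersBy G B p N) ?_ huP ⟨k, hk, w, hw, rfl⟩
      hf.adj.symm ?_ ?_⟩
    -- `w` is active at time `N`, or performs a force later than time `k + 1`.
    · by_cases hwL : w ∈ forcersBy G B p N
      · obtain ⟨l, hl, z, hz, hzw⟩ := hwL
        have hfz := hp l (hl.trans_le hN) z hz
        have hkl : k < l := lt_of_newlyBlue_of_mem_blueAfter hw (hzw ▸ hfz.1)
        rw [← hzw]
        exact ih hl (by omega) hz
      · exact blueAfter_mono _ _ j.zero_le ⟨newlyBlue_subset_blueAfter hk hw, hwL⟩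
    · intro x hx y _ hy hxy
      by_contra hyL
      exact hy (blueAfter_mono _ _ j.zero_le ⟨hp.mem_blueAfter_of_adj hN hx hxy, hyL⟩)
    -- A forcer adjacent to `w` performs its force at time `k + 1` or later, hence, being still
    -- white, exactly at time `k + 1`, when `w` is its only white neighbor.
    · rintro _ ⟨l, hl, z, hz, rfl⟩ hyP hy
      have hfz := hp l (hl.trans_le hN) z hz
      have hkl : k < l + 1 := lt_of_newlyBlue_of_mem_blueAfter hw
        (mem_blueAfter_of_adj_forcer hfz hy.symm l.lt_succ_self)
      have hlj : ¬ N ≤ l + j := fun h => hyP (ih hl h hz)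
      obtain rfl : k = l := by omega
      rw [hfz.eq_of_adj hy.symm hf.notMem]

lemma ChoosesForcers.psd_blueAfter_eq_univ (hp : ChoosesForcers G B p T)
    (hT : blueAfter (standardRule G) B T = Set.univ) (hN : N ≤ T) (hTN : T ≤ N + N) :
    blueAfter (psdRule G) (blueAfter (standardRule G) B N \ forcersBy G B p N) N = Set.univ := by
  refine Set.eq_univ_of_forall fun v => ?_
  by_cases hv : v ∈ forcersBy G B p N
  · obtain ⟨k, hk, u, hu, rfl⟩ := hv
    exact hp.forcer_mem_psd_blueAfter hN N hk (Nat.le_add_left N k) hu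
  · refine blueAfter_mono _ _ (show T - N ≤ N by omega)
      (hp.blueAfter_subset_psd_blueAfter (by omega) ⟨?_, hv⟩)
    rw [Nat.add_sub_cancel' hN, hT]
    exact Set.mem_univ v

end ZeroForcing

theorem theorem4p7 {V : Type*} [Fintype V] (G : SimpleGraph V) (m : ℕ)
    (hm : ZeroForcing.Z G ≤ m) (hmV : m ≤ Fintype.card V) :
    ZeroForcing.ptPlus G m ≤ ⌈(ZeroForcing.pt G m : ℚ) / 2⌉₊ ∧
    (∃ (B : Set V) (F : ℕ → Set (V × V)),
      ZeroForcing.IsEfficientForcingSet (ZeroForcing.standardRule G) m B ∧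
      ZeroForcing.IsPropagatingFamily (ZeroForcing.standardRule G) B F) ∧
    ∀ (B : Set V) (F : ℕ → Set (V × V)),
      ZeroForcing.IsEfficientForcingSet (ZeroForcing.standardRule G) m B →
      ZeroForcing.IsPropagatingFamily (ZeroForcing.standardRule G) B F →
      ZeroForcing.IsForcingSet (ZeroForcing.psdRule G)
        (ZeroForcing.activeSet (ZeroForcing.standardRule G) B F
          ⌈(ZeroForcing.pt G m : ℚ) / 2⌉₊) ∧
      (ZeroForcing.activeSet (ZeroForcing.standardRule G) B F
          ⌈(ZeroForcing.pt G m : ℚ) / 2⌉₊).ncard = m ∧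
      ZeroForcing.propTime (ZeroForcing.psdRule G)
        (ZeroForcing.activeSet (ZeroForcing.standardRule G) B F
          ⌈(ZeroForcing.pt G m : ℚ) / 2⌉₊) ≤ ⌈(ZeroForcing.pt G m : ℚ) / 2⌉₊ := by
  have hN : ⌈(ZeroForcing.pt G m : ℚ) / 2⌉₊ ≤ ZeroForcing.pt G m :=
    Nat.ceil_le.mpr (half_le_self (Nat.cast_nonneg _))
  have hTN : ZeroForcing.pt G m ≤
      ⌈(ZeroForcing.pt G m : ℚ) / 2⌉₊ + ⌈(ZeroForcing.pt G m : ℚ) / 2⌉₊ := by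
    have h := Nat.le_ceil ((ZeroForcing.pt G m : ℚ) / 2)
    have h' : (ZeroForcing.pt G m : ℚ) ≤
        ⌈(ZeroForcing.pt G m : ℚ) / 2⌉₊ + ⌈(ZeroForcing.pt G m : ℚ) / 2⌉₊ := by linarith
    exact_mod_cast h'
  generalize ⌈(ZeroForcing.pt G m : ℚ) / 2⌉₊ = N at hN hTN ⊢
  have key : ∀ (B : Set V) (F : ℕ → Set (V × V)),
      ZeroForcing.IsEfficientForcingSet (ZeroForcing.standardRule G) m B →
      ZeroForcing.IsPropagatingFamily (ZeroForcing.standardRule G) B F →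
      ZeroForcing.IsForcingSet (ZeroForcing.psdRule G)
        (ZeroForcing.activeSet (ZeroForcing.standardRule G) B F N) ∧
      (ZeroForcing.activeSet (ZeroForcing.standardRule G) B F N).ncard = m ∧
      ZeroForcing.propTime (ZeroForcing.psdRule G)
        (ZeroForcing.activeSet (ZeroForcing.standardRule G) B F N) ≤ N := by
    rintro B F ⟨hB, hcard, ht⟩ hF
    change _ = ZeroForcing.pt G m at ht
    rw [← ht] at hN hTN
    obtain ⟨p, hp, hactive⟩ := hF.exists_choosesForcers
    rw [hactive N hN]
    have huniv := hp.psd_blueAfter_eq_univ hB.blueAfter_propTime hN hTN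
    exact ⟨⟨N, huniv⟩, (hp.ncard_blueAfter_diff_forcersBy hN).trans hcard, Nat.sInf_le huniv⟩
  obtain ⟨B, hB⟩ := ZeroForcing.exists_isEfficientForcingSet hm hmV
  obtain ⟨F, hF⟩ := ZeroForcing.exists_isPropagatingFamily G B
  obtain ⟨hforce, hcard, hle⟩ := key B F hB hF
  exact ⟨(Nat.sInf_le ⟨_, hforce, hcard, rfl⟩ : ZeroForcing.ptPlus G m ≤ _).trans hle,
    ⟨B, F, hB, hF⟩, key⟩
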